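/- Let $G$ be a group. For a subset $A\subseteq G$ let $\mathrm{cov}(A)=\min\{|F| : F\subseteq G,\ G=FA\}$ be its covering number, with $\mathrm{cov}(\emptyset)=\infty$, where $\infty$ is larger than every cardinal. Then for every partition $G=A_1\cup\dots\cup A_n$ of $G$ into $n$ pairwise disjoint (possibly empty) cells, at least one of the following holds: $\mathrm{cov}(A_iA_i^{-1})\le n$ for all $i\in\{1,\dots,n\}$, or $\mathrm{cov}(A_iA_i^{-1}A_i)<n$ for some $i\in\{1,\dots,n\}$. -/

import Mathlib

open scoped Pointwise

universe u

/-- The covering number `cov(A) = min {|F| : F ⊆ G, G = F A}` of a subset `A` of a group `G`.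
It takes values in the cardinals with a largest element `∞ = ⊤` adjoined; the infimum over the
(well-ordered) cardinals is a minimum when some `F` exists, and it is `∞` when there is none,
that is, when `A` is empty. -/
noncomputable def cov {G : Type u} [Group G] (A : Set G) : WithTop Cardinal.{u} :=
  ⨅ (F : Set G) (_ : F * A = Set.univ), ((Cardinal.mk F : Cardinal.{u}) : WithTop Cardinal.{u})

/-!
Measure the cells with means, i.e. positive unital functionals on the real functions on `G`, and
write `n` for the number of cells. Since fewer than `m` disjoint sets can have mass above `1 / m`,
a maximal disjoint family among the translates `x • A` of mass above `1 / m` has fewer than `m`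
members, and the corresponding translates of `A * A⁻¹` cover all such `x`.

Suppose that `cov (A * A⁻¹ * A) ≥ n`. For every mean `μ` there is then an `h` such that all
translates `(h * a⁻¹) • A` with `a ∈ A` have mass at most `1 / n`. Hence `μ * δ_{h⁻¹} * μ` gives
little mass to `x • A` when `μ` gives it much, and replacing `μ` by the average of the two reduces
the excess of `sup_x μ (x • A)` over `1 / n` by a constant factor.
Convolving on the left preserves upper bounds on the masses of translates, so if this holds for all
cells, one mean makes the translates of all cells have mass barely above `1 / n`. As the cells cover
`G`, each translate of each cell then has mass above `1 / (n + 1)`, and the first paragraph with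
`m = n + 1` bounds `cov (A * A⁻¹)` by `n`.
-/

/-- A mean on `G`: a positive linear functional on the real functions on `G` mapping `1` to `1`.
It serves as a finitely additive probability measure on all subsets of `G`. Unbounded functions are
allowed, so that no boundedness has to be carried along. -/
structure Mean (G : Type*) extends (G → ℝ) →ₚ[ℝ] ℝ where
  map_one' : toFun 1 = 1

namespace Mean

variable {G : Type*}

instance : FunLike (Mean G) (G → ℝ) ℝ where
  coe μ := μ.toPositiveLinearMap
  coe_injective := by
    rintro ⟨μ, _⟩ ⟨ν, _⟩ h
    congr
    exact DFunLike.coe_injective h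

instance : LinearMapClass (Mean G) ℝ (G → ℝ) ℝ where
  map_add μ := map_add μ.toPositiveLinearMap
  map_smulₛₗ μ := map_smul μ.toPositiveLinearMap

instance : OrderHomClass (Mean G) (G → ℝ) ℝ where
  map_rel μ _ _ h := μ.monotone' h

protected theorem map_one (μ : Mean G) : μ 1 = 1 :=
  μ.map_one'

theorem map_const (μ : Mean G) (c : ℝ) : μ (fun _ => c) = c := by
  have hc : (fun _ : G => c) = c • (1 : G → ℝ) := by ext; simp
  rw [hc, map_smul, μ.map_one, smul_eq_mul, mul_one]

theorem apply_le_of_forall_le (μ : Mean G) {f : G → ℝ} {c : ℝ} (h : ∀ x, f x ≤ c) : μ f ≤ c :=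
  (OrderHomClass.mono μ h).trans_eq (μ.map_const c)

/-- The mass that a mean gives to a set. -/
noncomputable def prob (μ : Mean G) (s : Set G) : ℝ :=
  μ (s.indicator 1)

@[simp]
theorem prob_empty (μ : Mean G) : μ.prob ∅ = 0 := by
  rw [prob, Set.indicator_empty', map_zero]

theorem prob_le_one (μ : Mean G) (s : Set G) : μ.prob s ≤ 1 :=
  μ.apply_le_of_forall_le fun _ => Set.indicator_apply_le' (fun _ => le_rfl) fun _ => zero_le_one

section Families

variable {ι : Type*} {F : Finset ι} {s : ι → Set G}

theorem sum_prob_le_one (μ : Mean G) (hs : (F : Set ι).PairwiseDisjoint s) :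
    ∑ i ∈ F, μ.prob (s i) ≤ 1 := by
  have hunion : ∑ i ∈ F, (s i).indicator (1 : G → ℝ) = (⋃ i ∈ F, s i).indicator 1 := by
    ext x
    rw [Finset.indicator_biUnion F s hs, Finset.sum_apply]
  simp only [prob]
  rw [← map_sum, hunion]
  exact μ.prob_le_one _

theorem one_le_sum_prob [Fintype ι] (μ : Mean G) (hs : ⋃ i, s i = Set.univ) :
    1 ≤ ∑ i, μ.prob (s i) := by
  have hnonneg (i : ι) (x : G) : 0 ≤ (s i).indicator (1 : G → ℝ) x :=
    Set.indicator_nonneg (fun _ _ => zero_le_one) x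
  simp only [prob]
  rw [← map_sum, ← μ.map_one]
  refine OrderHomClass.mono μ fun x => ?_
  obtain ⟨i, hi⟩ := Set.iUnion_eq_univ_iff.1 hs x
  rw [Finset.sum_apply]
  calc (1 : G → ℝ) x = (s i).indicator 1 x := (Set.indicator_of_mem hi 1).symm
    _ ≤ ∑ j, (s j).indicator 1 x :=
      Finset.single_le_sum (fun j _ => hnonneg j x) (Finset.mem_univ i)

theorem card_mul_lt_one (μ : Mean G) (hs : (F : Set ι).PairwiseDisjoint s) {c : ℝ}
    (hc : ∀ i ∈ F, c < μ.prob (s i)) : F.card * c < 1 := by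
  rcases F.eq_empty_or_nonempty with rfl | hF
  · simp
  · calc F.card * c = ∑ _i ∈ F, c := by rw [Finset.sum_const, nsmul_eq_mul]
      _ < ∑ i ∈ F, μ.prob (s i) := Finset.sum_lt_sum_of_nonempty hF hc
      _ ≤ 1 := μ.sum_prob_le_one hs

end Families

/-- The Dirac mean at `g`, that is, evaluation at `g`. -/
def dirac (g : G) : Mean G where
  toLinearMap := LinearMap.proj g
  monotone' _ _ h := h g
  map_one' := rfl

theorem dirac_apply (g : G) (f : G → ℝ) : dirac g f = f g :=
  rfl

/-- The mean halfway between two means, used to average a mean with a convolution of it. -/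
noncomputable def average (μ ν : Mean G) : Mean G where
  toLinearMap := (1 / 2 : ℝ) • (μ.toLinearMap + ν.toLinearMap)
  monotone' _ _ h :=
    mul_le_mul_of_nonneg_left (add_le_add (μ.monotone' h) (ν.monotone' h)) (by norm_num)
  map_one' := by
    change 1 / 2 * (μ 1 + ν 1) = 1
    norm_num [Mean.map_one]

theorem average_apply (μ ν : Mean G) (f : G → ℝ) : average μ ν f = (μ f + ν f) / 2 :=
  one_div_mul_eq_div 2 (μ f + ν f)

/-- The convolution of means, `(ν * μ) f = ∫∫ f (t * s) dμ(s) dν(t)`. The order of integration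
matters, since means need not satisfy Fubini's theorem. -/
instance [Mul G] : Mul (Mean G) where
  mul ν μ :=
    { toLinearMap := ν.toLinearMap ∘ₗ
        LinearMap.pi fun t => μ.toLinearMap ∘ₗ LinearMap.funLeft ℝ ℝ (t * ·)
      monotone' := fun _ _ h => ν.monotone' fun t => μ.monotone' fun s => h (t * s)
      map_one' := by
        change ν (fun _ => μ 1) = 1
        rw [μ.map_one, ν.map_const] }

theorem mul_apply [Mul G] (ν μ : Mean G) (f : G → ℝ) :
    (ν * μ) f = ν fun t => μ fun s => f (t * s) :=
  rfl

instance [Semigroup G] : Semigroup (Mean G) where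
  mul_assoc κ ν μ := DFunLike.ext _ _ fun f => by simp only [mul_apply, mul_assoc]

variable [Group G]

theorem prob_mul (ν μ : Mean G) (s : Set G) : (ν * μ).prob s = ν fun t => μ.prob (t⁻¹ • s) := by
  have hindicator (t : G) :
      (fun x => s.indicator (1 : G → ℝ) (t * x)) = (t⁻¹ • s).indicator 1 := by
    classical
    ext x
    simp only [Set.indicator_apply, Set.mem_inv_smul_set_iff, smul_eq_mul, Pi.one_apply]
  simp only [prob, mul_apply, hindicator]

theorem prob_mul_smul_le (ν : Mean G) {μ : Mean G} {A : Set G} {c : ℝ}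
    (h : ∀ x : G, μ.prob (x • A) ≤ c) (x : G) : (ν * μ).prob (x • A) ≤ c := by
  rw [prob_mul]
  refine ν.apply_le_of_forall_le fun t => ?_
  rw [smul_smul]
  exact h (t⁻¹ * x)

end Mean

section Packing

variable {G : Type*} [Group G] {A B : Set G}

theorem pairwiseDisjoint_smul_insert {F : Set G} (hF : F.PairwiseDisjoint (· • A)) {x : G}
    (hx : x ∉ F * (A * A⁻¹)) : (insert x F).PairwiseDisjoint (· • A) := by
  refine hF.insert fun y hy _ => Set.disjoint_left.2 ?_
  rintro _ ⟨a, ha, rfl⟩ ⟨b, hb, hba : y * b = x * a⟩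
  refine hx ⟨y, hy, b * a⁻¹, Set.mul_mem_mul hb (Set.inv_mem_inv.2 ha), ?_⟩
  change y * (b * a⁻¹) = x
  rw [← mul_assoc, hba, mul_inv_cancel_right]

theorem exists_subset_mul_mul_inv_of_packing_le (hA : A.Nonempty) {k : ℕ}
    (hpack : ∀ F : Finset G, (F : Set G) ⊆ B → (F : Set G).PairwiseDisjoint (· • A) →
      F.card ≤ k) :
    ∃ F : Finset G, F.card ≤ k ∧ B ⊆ F * (A * A⁻¹) := by
  classical
  by_contra! hcover
  have hlarge (m : ℕ) : ∃ F : Finset G, (F : Set G) ⊆ B ∧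
      (F : Set G).PairwiseDisjoint (· • A) ∧ F.card = m := by
    induction m with
    | zero => exact ⟨∅, by simp⟩
    | succ m ih =>
      obtain ⟨F, hFB, hF, rfl⟩ := ih
      obtain ⟨x, hxB, hx⟩ := Set.not_subset.1 (hcover F (hpack F hFB hF))
      have hxF : x ∉ F := fun hxF => by
        obtain ⟨a, ha⟩ := hA
        exact hx ⟨x, hxF, 1, ⟨a, ha, a⁻¹, Set.inv_mem_inv.2 ha, mul_inv_cancel a⟩, mul_one x⟩
      refine ⟨insert x F, ?_, ?_, Finset.card_insert_of_notMem hxF⟩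
      · rw [Finset.coe_insert]
        exact Set.insert_subset hxB hFB
      · rw [Finset.coe_insert]
        exact pairwiseDisjoint_smul_insert hF hx
  obtain ⟨F, hFB, hF, hcard⟩ := hlarge (k + 1)
  have := hpack F hFB hF
  omega

theorem Mean.exists_card_lt_setOf_lt_prob_subset (μ : Mean G) (A : Set G) {m : ℕ} (hm : 0 < m) :
    ∃ F : Finset G, F.card < m ∧ {x : G | 1 / (m : ℝ) < μ.prob (x • A)} ⊆ F * (A * A⁻¹) := by
  have hm' : (0 : ℝ) < m := Nat.cast_pos.2 hm
  rcases A.eq_empty_or_nonempty with rfl | hA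
  · have hempty : {x : G | 1 / (m : ℝ) < μ.prob (x • ∅)} = ∅ := by simp [hm'.not_gt]
    exact ⟨∅, hm, hempty.trans_subset (Set.empty_subset _)⟩
  · obtain ⟨F, hFcard, hF⟩ := exists_subset_mul_mul_inv_of_packing_le hA (k := m - 1)
      (B := {x | 1 / (m : ℝ) < μ.prob (x • A)}) fun F hFB hF => by
        have hmass := μ.card_mul_lt_one hF fun x hx => hFB hx
        rw [mul_one_div, div_lt_one hm'] at hmass
        exact Nat.le_sub_one_of_lt (Nat.cast_lt.1 hmass)
    exact ⟨F, by omega, hF⟩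

end Packing

section Covering

variable {G : Type u} [Group G] {A : Set G}

theorem cov_le_card {F : Finset G} (hF : (F : Set G) * A = Set.univ) :
    cov A ≤ (F.card : WithTop Cardinal.{u}) := by
  refine (iInf₂_le (F : Set G) hF).trans_eq ?_
  simp

theorem cov_mul_inv_le_of_forall_lt_prob {n : ℕ} {μ : Mean G}
    (h : ∀ x : G, 1 / ((n : ℝ) + 1) < μ.prob (x • A)) :
    cov (A * A⁻¹) ≤ (n : WithTop Cardinal.{u}) := by
  obtain ⟨F, hFcard, hF⟩ := μ.exists_card_lt_setOf_lt_prob_subset A n.succ_pos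
  have hcover : (F : Set G) * (A * A⁻¹) = Set.univ :=
    Set.eq_univ_of_forall fun x => hF (by simpa using h x)
  exact (cov_le_card hcover).trans (Nat.cast_le.2 (Nat.le_of_lt_succ hFcard))

theorem exists_forall_prob_le_of_le_cov {n : ℕ} (hn : 0 < n)
    (hcov : (n : WithTop Cardinal.{u}) ≤ cov (A * A⁻¹ * A)) (μ : Mean G) :
    ∃ h : G, ∀ a ∈ A, μ.prob ((h * a⁻¹) • A) ≤ 1 / n := by
  by_contra! hlarge
  obtain ⟨F, hFcard, hF⟩ := μ.exists_card_lt_setOf_lt_prob_subset A hn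
  have hcover : (F : Set G) * (A * A⁻¹ * A) = Set.univ := Set.eq_univ_of_forall fun g => by
    obtain ⟨a, ha, hga⟩ := hlarge g
    rw [← mul_assoc]
    exact ⟨g * a⁻¹, hF hga, a, ha, inv_mul_cancel_right g a⟩
  exact (hcov.trans (cov_le_card hcover)).not_gt (Nat.cast_lt.2 hFcard)

end Covering

section Averaging

variable {G : Type*} [Group G] {A : Set G} {μ : Mean G} {α d : ℝ} {h : G}

theorem Mean.apply_prob_smul_le (hh : ∀ a ∈ A, μ.prob ((h * a⁻¹) • A) ≤ α)
    (hμ : ∀ x : G, μ.prob (x • A) ≤ α + d) (x : G) :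
    μ (fun s => μ.prob ((h * s⁻¹ * x) • A)) ≤ α + d - d * μ.prob (x • A) := by
  have hpointwise : (fun s => μ.prob ((h * s⁻¹ * x) • A)) ≤
      (fun _ => α + d) - d • (x • A).indicator 1 := fun s => by
    simp only [Pi.sub_apply, Pi.smul_apply, smul_eq_mul]
    by_cases hs : s ∈ x • A
    · rw [Set.indicator_of_mem hs, Pi.one_apply, mul_one, add_sub_cancel_right]
      obtain ⟨a, ha, rfl⟩ := hs
      simpa [mul_assoc] using hh a ha
    · simpa [hs] using hμ (h * s⁻¹ * x)
  calc μ (fun s => μ.prob ((h * s⁻¹ * x) • A))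
      ≤ μ ((fun _ => α + d) - d • (x • A).indicator 1) := OrderHomClass.mono μ hpointwise
    _ = α + d - d * μ.prob (x • A) := by rw [map_sub, map_smul, μ.map_const]; rfl

theorem Mean.exists_mul_prob_smul_le_add_mul (hd₀ : 0 ≤ d) (hd₁ : d ≤ 1)
    (hh : ∀ a ∈ A, μ.prob ((h * a⁻¹) • A) ≤ α) (hμ : ∀ x : G, μ.prob (x • A) ≤ α + d) :
    ∃ ν : Mean G, ∀ x : G, (ν * μ).prob (x • A) ≤ α + (1 - α / 2) * d := by
  refine ⟨average (dirac 1) (μ * dirac h⁻¹), fun x => ?_⟩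
  have hsplit : (average (dirac 1) (μ * dirac h⁻¹) * μ).prob (x • A) =
      (μ.prob (x • A) + μ fun s => μ.prob ((h * s⁻¹ * x) • A)) / 2 := by
    simp [prob_mul, average_apply, mul_apply, dirac_apply, smul_smul]
  have hcontract : (1 - d) * μ.prob (x • A) ≤ (1 - d) * (α + d) :=
    mul_le_mul_of_nonneg_left (hμ x) (sub_nonneg.2 hd₁)
  rw [hsplit]
  nlinarith [Mean.apply_prob_smul_le hh hμ x]

end Averaging

section SmallTranslates

variable {G : Type u} [Group G] {n : ℕ}

theorem exists_mul_prob_smul_le_add_pow (hn : 0 < n) {A : Set G}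
    (hcov : (n : WithTop Cardinal.{u}) ≤ cov (A * A⁻¹ * A)) (μ : Mean G) (k : ℕ) :
    ∃ ν : Mean G, ∀ x : G, (ν * μ).prob (x • A) ≤ 1 / n + (1 - 1 / (n : ℝ) / 2) ^ k := by
  have hn' : 1 / (n : ℝ) ≤ 1 := (one_div (n : ℝ)).trans_le (Nat.cast_inv_le_one n)
  have hr₀ : 0 ≤ 1 - 1 / (n : ℝ) / 2 := by linarith
  have hr₁ : 1 - 1 / (n : ℝ) / 2 ≤ 1 := sub_le_self _ (by positivity)
  induction k with
  | zero =>
    refine ⟨μ, fun x => ((μ * μ).prob_le_one _).trans ?_⟩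
    rw [pow_zero]
    exact le_add_of_nonneg_left (by positivity)
  | succ k ih =>
    obtain ⟨ν, hν⟩ := ih
    obtain ⟨h, hh⟩ := exists_forall_prob_le_of_le_cov hn hcov (ν * μ)
    obtain ⟨ρ, hρ⟩ := Mean.exists_mul_prob_smul_le_add_mul (pow_nonneg hr₀ k)
      (pow_le_one₀ hr₀ hr₁) hh hν
    exact ⟨ρ * ν, fun x => by simpa only [mul_assoc, pow_succ'] using hρ x⟩

theorem exists_mul_prob_smul_le (hn : 0 < n) {A : Set G}
    (hcov : (n : WithTop Cardinal.{u}) ≤ cov (A * A⁻¹ * A)) (μ : Mean G) {c : ℝ}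
    (hc : 1 / (n : ℝ) < c) : ∃ ν : Mean G, ∀ x : G, (ν * μ).prob (x • A) ≤ c := by
  have hr : 1 - 1 / (n : ℝ) / 2 < 1 := sub_lt_self _ (by positivity)
  obtain ⟨k, hk⟩ := exists_pow_lt_of_lt_one (sub_pos.2 hc) hr
  obtain ⟨ν, hν⟩ := exists_mul_prob_smul_le_add_pow hn hcov μ k
  exact ⟨ν, fun x => (hν x).trans (by linarith)⟩

theorem exists_forall_mem_prob_smul_le (hn : 0 < n) {ι : Type*} {A : ι → Set G}
    (hcov : ∀ i, (n : WithTop Cardinal.{u}) ≤ cov (A i * (A i)⁻¹ * A i)) {c : ℝ}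
    (hc : 1 / (n : ℝ) < c) (I : Finset ι) :
    ∃ μ : Mean G, ∀ i ∈ I, ∀ x : G, μ.prob (x • A i) ≤ c := by
  classical
  induction I using Finset.induction_on with
  | empty => exact ⟨Mean.dirac 1, by simp⟩
  | insert i I _ ih =>
    obtain ⟨μ, hμ⟩ := ih
    obtain ⟨ν, hν⟩ := exists_mul_prob_smul_le hn (hcov i) μ hc
    refine ⟨ν * μ, fun j hj => ?_⟩
    rcases Finset.mem_insert.1 hj with rfl | hj
    · exact hν
    · exact ν.prob_mul_smul_le (hμ j hj)

end SmallTranslates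

theorem Mean.one_sub_le_prob_smul {G ι : Type*} [Group G] [Fintype ι] {A : ι → Set G}
    (hcover : ⋃ i, A i = Set.univ) {μ : Mean G} {c : ℝ}
    (hμ : ∀ i, ∀ x : G, μ.prob (x • A i) ≤ c) (i : ι) (x : G) :
    1 - (Fintype.card ι - 1) * c ≤ μ.prob (x • A i) := by
  classical
  have hcover' : ⋃ j, x • A j = Set.univ := by
    rw [← Set.smul_set_iUnion, hcover, Set.smul_set_univ]
  have hrest : ∑ j ∈ Finset.univ.erase i, μ.prob (x • A j) ≤ (Fintype.card ι - 1) * c := by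
    refine (Finset.sum_le_card_nsmul _ _ _ fun j _ => hμ j x).trans_eq ?_
    rw [nsmul_eq_mul, Finset.cast_card_erase_of_mem (Finset.mem_univ i), Finset.card_univ]
  have htotal := μ.one_le_sum_prob hcover'
  rw [← Finset.add_sum_erase _ _ (Finset.mem_univ i)] at htotal
  linarith

theorem corollary2_general {G : Type u} [Group G] {ι : Type*} [Fintype ι] (A : ι → Set G)
    (hcover : ⋃ i, A i = Set.univ) :
    (∀ i, cov (A i * (A i)⁻¹) ≤ (Fintype.card ι : WithTop Cardinal.{u})) ∨
      ∃ i, cov (A i * (A i)⁻¹ * A i) < (Fintype.card ι : WithTop Cardinal.{u}) := by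
  refine or_iff_not_imp_right.2 fun hcov i => ?_
  push Not at hcov
  have hcard : 0 < Fintype.card ι := Fintype.card_pos_iff.2 ⟨i⟩
  set n := Fintype.card ι
  -- Any `c > 1 / n` with `(n - 1) * c < 1 - 1 / (n + 1)` would do.
  set c : ℝ := 1 / n + 1 / (n ^ 2 * (n + 1)) with hc
  obtain ⟨μ, hμ⟩ := exists_forall_mem_prob_smul_le hcard hcov
    (show 1 / (n : ℝ) < c from lt_add_of_pos_right _ (by positivity)) Finset.univ
  refine cov_mul_inv_le_of_forall_lt_prob (μ := μ) fun x => ?_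
  calc 1 / ((n : ℝ) + 1) < 1 / (n + 1) + 1 / (n ^ 2 * (n + 1)) :=
        lt_add_of_pos_right _ (by positivity)
    _ = 1 - (n - 1) * c := by rw [hc]; field_simp; ring
    _ ≤ μ.prob (x • A i) := Mean.one_sub_le_prob_smul hcover (fun j => hμ j (Finset.mem_univ j)) i x

/-- For a partition of a group into `n` pairwise disjoint (possibly empty) cells. -/
theorem corollary2 {G : Type u} [Group G] (n : ℕ) (A : Fin n → Set G)
    (hdisj : Pairwise fun i j => Disjoint (A i) (A j))
    (hcover : (⋃ i, A i) = Set.univ) :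
    (∀ i, cov (A i * (A i)⁻¹) ≤ (n : WithTop Cardinal.{u})) ∨
      ∃ i, cov (A i * (A i)⁻¹ * A i) < (n : WithTop Cardinal.{u}) := by
  simpa only [Fintype.card_fin] using corollary2_general A hcover
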